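/- **Theorem 1 (generalized decoupling theorem).** Let $C=C_1\otimes C_2\otimes C_3$, $F$ and $E$ be finite-dimensional complex Hilbert spaces, and write $d_X$ for the dimension of $X$, so that $d_C=d_{C_1}d_{C_2}d_{C_3}$, $d_{C_2C_3}=d_{C_2}d_{C_3}$ and $d_{C_1C_3}=d_{C_1}d_{C_3}$. For any density operators (positive semidefinite operators of trace one) $\omega_{CF}$ on $C\otimes F$ and $\psi_{CE}$ on $C\otimes E$, there exists a single unitary operator $U$ on $C$ such that both $$\left\Vert \mathrm{Tr}_{C_2C_3}[U\cdot\omega_{CF}]-\pi_{C_1}\otimes\omega_F\right\Vert_1^2\le 2\alpha \qquad\text{and}\qquad \left\Vert \mathrm{Tr}_{C_1C_3}[U\cdot\psi_{CE}]-\pi_{C_2}\otimes\psi_E\right\Vert_1^2\le 2\beta,$$ where $$\alpha=\frac{d_C\,d_F\,\mathrm{Tr}\left[(\omega_{CF})^2\right]}{d_{C_2C_3}^2},\qquad \beta=\frac{d_C\,d_E\,\mathrm{Tr}\left[(\psi_{CE})^2\right]}{d_{C_1C_3}^2}.$$ Here $U\cdot\rho=(U\otimes I)\,\rho\,(U\otimes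 I)^{-1}$, with $I$ the identity on $F$ (respectively $E$); $\mathrm{Tr}_{X}$ is the partial trace over $X$; $\pi_{X}=I_{X}/d_{X}$ is the maximally mixed state on $X$; $\omega_F=\mathrm{Tr}_C\,\omega_{CF}$ and $\psi_E=\mathrm{Tr}_C\,\psi_{CE}$ are the reduced states; and $\left\Vert\rho\right\Vert_1=\mathrm{Tr}\sqrt{\rho^\dagger\rho}$ is the trace norm. -/

import Mathlib

open scoped Kronecker Matrix MatrixOrder ComplexOrder

noncomputable section

/-- A density operator on the Hilbert space with orthonormal basis indexed by `n`:
a positive semidefinite matrix of trace one. -/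
def IsDensityOperator {n : Type*} [Fintype n] (ρ : Matrix n n ℂ) : Prop :=
  ρ.PosSemidef ∧ ρ.trace = 1

/-- The trace norm `‖M‖₁ = Tr √(M† M)`. -/
def traceNorm {n : Type*} [Fintype n] [DecidableEq n] (M : Matrix n n ℂ) : ℝ :=
  (CFC.sqrt (Mᴴ * M)).trace.re

/-- The purity `Tr (ρ²)`. -/
def purity {n : Type*} [Fintype n] (ρ : Matrix n n ℂ) : ℝ :=
  (ρ * ρ).trace.re

/-- The maximally mixed state `π = 1 / d`. -/
def maxMixed (n : Type*) [Fintype n] [DecidableEq n] : Matrix n n ℂ :=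
  (Fintype.card n : ℂ)⁻¹ • 1

/-- The adjoint action `U · ρ = (U ⊗ 1) ρ (U ⊗ 1)⁻¹` of a unitary `U` on the system `C`
on an operator on the composite system `C F`. -/
def adjointAction {c f : Type*} [Fintype c] [DecidableEq c] [Fintype f] [DecidableEq f]
    (U : Matrix.unitaryGroup c ℂ) (ρ : Matrix (c × f) (c × f) ℂ) :
    Matrix (c × f) (c × f) ℂ :=
  ((U : Matrix c c ℂ) ⊗ₖ (1 : Matrix f f ℂ)) * ρ *
    (((U⁻¹ : Matrix.unitaryGroup c ℂ) : Matrix c c ℂ) ⊗ₖ (1 : Matrix f f ℂ))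

/-- The reduced operator on `F` of an operator on `C F`: the partial trace over `C`. -/
def traceC {c f : Type*} [Fintype c] (ρ : Matrix (c × f) (c × f) ℂ) : Matrix f f ℂ :=
  Matrix.of fun i j => ∑ x : c, ρ (x, i) (x, j)

/-- For `C = C₁ C₂ C₃`, the partial trace over `C₂ C₃` of an operator on `C F`. -/
def traceC2C3 {c₁ c₂ c₃ f : Type*} [Fintype c₂] [Fintype c₃]
    (ρ : Matrix ((c₁ × c₂ × c₃) × f) ((c₁ × c₂ × c₃) × f) ℂ) :
    Matrix (c₁ × f) (c₁ × f) ℂ :=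
  Matrix.of fun i j =>
    ∑ y : c₂, ∑ z : c₃, ρ ((i.1, y, z), i.2) ((j.1, y, z), j.2)

/-- For `C = C₁ C₂ C₃`, the partial trace over `C₁ C₃` of an operator on `C E`. -/
def traceC1C3 {c₁ c₂ c₃ e : Type*} [Fintype c₁] [Fintype c₃]
    (ρ : Matrix ((c₁ × c₂ × c₃) × e) ((c₁ × c₂ × c₃) × e) ℂ) :
    Matrix (c₂ × e) (c₂ × e) ℂ :=
  Matrix.of fun i j =>
    ∑ x : c₁, ∑ z : c₃, ρ ((x, i.1, z), i.2) ((x, j.1, z), j.2)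

end

/-!
Average over Haar measure on the unitary group of `C`. For a partition `C = A B` write
`Δ(U) = Tr_B (U · ρ) - π_A ⊗ ρ_F`. By Cauchy-Schwarz, `‖Δ‖₁² ≤ d_A d_F Tr Δ²`
(`traceNorm_sq_le`), and since `Tr_A` of `Tr_B (U · ρ)` is `ρ_F` for every `U`,
`Tr Δ(U)² = Tr (Tr_B (U · ρ))² - Tr ρ_F² / d_A` (`purity_decouplingError`).

The swap trick turns `Tr (Tr_B (U · ρ))²` into the trace of `(U ⊗ U)† X (U ⊗ U)` against an
operator depending only on `ρ`, where `X` exchanges the `A` parts of two copies of `C`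
(`trace_traceB_adjointAction_mul_self`). The average of `(U ⊗ U)† X (U ⊗ U)` commutes with every
`V ⊗ V`, hence equals `p 1 + q F` with `F` the swap (`exists_eq_one_add_swap`); the traces of `X`
and `X F` give `p ≤ 1 / d_A` and `q ≤ 1 / d_B` (`twirl_coefficients_le`). Therefore the average of
`Tr Δ²` is at most `Tr ρ² / d_B` (`integral_purity_decouplingError_le`).

Applying this to `ω` with `B = C₂ C₃` and to `ψ` with `B = C₁ C₃`, the sum of the two errors, each
divided by its bound, has average at most two. Some `U` does not exceed this average, and then
neither error exceeds twice its bound; this is where the factor two comes from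
(`exists_le_two_mul_and_le_two_mul`).
-/

open MeasureTheory

/-! ### Haar measure on the unitary group and the twirl -/

section Haar

variable {n : Type*} [Fintype n] [DecidableEq n]

instance compactSpace_unitaryGroup : CompactSpace (Matrix.unitaryGroup n ℂ) := by
  refine (isCompact_iff_compactSpace (s := (Matrix.unitaryGroup n ℂ : Set (Matrix n n ℂ)))).mp ?_
  have hbox : IsCompact (Set.univ.pi fun _ : n => Set.univ.pi fun _ : n =>
      Metric.closedBall (0 : ℂ) 1) :=
    isCompact_univ_pi fun _ => isCompact_univ_pi fun _ => isCompact_closedBall _ _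
  have hclosed : IsClosed (Matrix.unitaryGroup n ℂ : Set (Matrix n n ℂ)) := isClosed_unitary
  refine IsCompact.of_isClosed_subset (X := Matrix n n ℂ) hbox hclosed fun U hU => ?_
  exact fun i _ j _ => mem_closedBall_zero_iff.mpr (entry_norm_bound_of_unitary hU i j)

/-- Haar measure on the unitary group, in the form used for averaging: a right-invariant
probability measure on the Borel sets. -/
theorem exists_rightInvariant_probability :
    ∃ (_ : MeasurableSpace (Matrix.unitaryGroup n ℂ)) (_ : BorelSpace (Matrix.unitaryGroup n ℂ))
      (μ : Measure (Matrix.unitaryGroup n ℂ)), IsProbabilityMeasure μ ∧ μ.IsMulRightInvariant := by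
  let _ : MeasurableSpace (Matrix.unitaryGroup n ℂ) := borel _
  have : BorelSpace (Matrix.unitaryGroup n ℂ) := ⟨rfl⟩
  let μ : Measure (Matrix.unitaryGroup n ℂ) := Measure.haarMeasure ⊤
  have : IsProbabilityMeasure μ := ⟨Measure.haarMeasure_self (K₀ := ⊤)⟩
  exact ⟨inferInstance, inferInstance, μ.inv,
    ⟨by rw [Measure.inv_apply, Set.inv_univ, measure_univ]⟩, inferInstance⟩

/-- The conjugation `X ↦ (U ⊗ U)† X (U ⊗ U)`. -/
def conjTensorSq (X : Matrix (n × n) (n × n) ℂ) (U : Matrix.unitaryGroup n ℂ) :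
    Matrix (n × n) (n × n) ℂ :=
  ((U : Matrix n n ℂ) ⊗ₖ (U : Matrix n n ℂ))ᴴ * X * ((U : Matrix n n ℂ) ⊗ₖ (U : Matrix n n ℂ))

theorem kronecker_self_mem_unitaryGroup (U : Matrix.unitaryGroup n ℂ) :
    (U : Matrix n n ℂ) ⊗ₖ (U : Matrix n n ℂ) ∈ Matrix.unitaryGroup (n × n) ℂ :=
  Matrix.kronecker_mem_unitary U.2 U.2

theorem conjTensorSq_mul (X : Matrix (n × n) (n × n) ℂ) (U V : Matrix.unitaryGroup n ℂ) :
    conjTensorSq X (U * V) = conjTensorSq (conjTensorSq X U) V := by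
  simp only [conjTensorSq, Submonoid.coe_mul, Matrix.mul_kronecker_mul,
    Matrix.conjTranspose_mul, Matrix.mul_assoc]

theorem continuous_conjTensorSq (X : Matrix (n × n) (n × n) ℂ) :
    Continuous (conjTensorSq X) := by
  have h : Continuous fun U : Matrix.unitaryGroup n ℂ =>
      (U : Matrix n n ℂ) ⊗ₖ (U : Matrix n n ℂ) := by
    refine continuous_matrix fun i j => ?_
    simp only [Matrix.kroneckerMap_apply]
    exact ((continuous_subtype_val.matrix_elem _ _).mul
      (continuous_subtype_val.matrix_elem _ _))
  exact (h.matrix_conjTranspose.matrix_mul continuous_const).matrix_mul h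

variable [MeasurableSpace (Matrix.unitaryGroup n ℂ)] [BorelSpace (Matrix.unitaryGroup n ℂ)]

theorem integrable_of_continuous_unitaryGroup {E : Type*} [NormedAddCommGroup E]
    (μ : Measure (Matrix.unitaryGroup n ℂ)) [IsProbabilityMeasure μ]
    {φ : Matrix.unitaryGroup n ℂ → E} (hφ : Continuous φ) : Integrable φ μ :=
  hφ.integrable_of_hasCompactSupport (HasCompactSupport.of_compactSpace φ)

/-- The average of `(U ⊗ U)† X (U ⊗ U)` over the unitary group. -/
noncomputable def twirl (μ : Measure (Matrix.unitaryGroup n ℂ)) (X : Matrix (n × n) (n × n) ℂ) :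
    Matrix (n × n) (n × n) ℂ :=
  Matrix.of fun i j => ∫ U, conjTensorSq X U i j ∂μ

variable (μ : Measure (Matrix.unitaryGroup n ℂ)) [IsProbabilityMeasure μ]

theorem integrable_conjTensorSq (X : Matrix (n × n) (n × n) ℂ) (i j : n × n) :
    Integrable (fun U => conjTensorSq X U i j) μ :=
  integrable_of_continuous_unitaryGroup μ ((continuous_conjTensorSq X).matrix_elem i j)

/-- Averaging commutes with multiplication by constant matrices. -/
theorem mul_twirl_mul_apply (X A B : Matrix (n × n) (n × n) ℂ) (i j : n × n) :
    (A * twirl μ X * B) i j = ∫ U, (A * conjTensorSq X U * B) i j ∂μ := by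
  simp only [Matrix.mul_apply, Finset.sum_mul, twirl, Matrix.of_apply]
  rw [integral_finsetSum _ fun k _ => integrable_finsetSum _ fun l _ =>
    ((integrable_conjTensorSq μ X _ _).const_mul _).mul_const _]
  refine Finset.sum_congr rfl fun k _ => ?_
  rw [integral_finsetSum _ fun l _ =>
    ((integrable_conjTensorSq μ X _ _).const_mul _).mul_const _]
  refine Finset.sum_congr rfl fun l _ => ?_
  rw [integral_mul_const, integral_const_mul]

theorem trace_twirl_mul (X B : Matrix (n × n) (n × n) ℂ) :
    (twirl μ X * B).trace = ∫ U, (conjTensorSq X U * B).trace ∂μ := by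
  simp only [Matrix.trace, Matrix.diag_apply]
  rw [integral_finsetSum _ fun i _ => integrable_of_continuous_unitaryGroup μ
    (((continuous_conjTensorSq X).matrix_mul continuous_const).matrix_elem i i)]
  refine Finset.sum_congr rfl fun i _ => ?_
  simpa using mul_twirl_mul_apply μ X 1 B i i

/-- The twirl commutes with every `V ⊗ V`, by right-invariance of the measure. -/
theorem conjTensorSq_twirl [μ.IsMulRightInvariant] (X : Matrix (n × n) (n × n) ℂ)
    (V : Matrix.unitaryGroup n ℂ) : conjTensorSq (twirl μ X) V = twirl μ X := by
  ext i j
  rw [conjTensorSq, mul_twirl_mul_apply]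
  change ∫ U, conjTensorSq (conjTensorSq X U) V i j ∂μ = ∫ U, conjTensorSq X U i j ∂μ
  simp_rw [← conjTensorSq_mul]
  exact integral_mul_right_eq_self (fun U => conjTensorSq X U i j) V

end Haar

/-! ### Operators commuting with all `V ⊗ V` -/

section Commutant

variable {n : Type*} [Fintype n] [DecidableEq n]

theorem mul_kronecker_self_comm {T : Matrix (n × n) (n × n) ℂ} {V : Matrix.unitaryGroup n ℂ}
    (h : conjTensorSq T V = T) :
    T * ((V : Matrix n n ℂ) ⊗ₖ (V : Matrix n n ℂ)) =
      ((V : Matrix n n ℂ) ⊗ₖ (V : Matrix n n ℂ)) * T := by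
  have hV := (Matrix.mem_unitaryGroup_iff).mp (kronecker_self_mem_unitaryGroup V)
  rw [Matrix.star_eq_conjTranspose] at hV
  conv_rhs => rw [← h, conjTensorSq]
  simp only [← Matrix.mul_assoc]
  rw [hV, Matrix.one_mul]

/-- The diagonal unitary with entry `i` at position `k` and `1` elsewhere. -/
def phaseUnitary (k : n) : Matrix.unitaryGroup n ℂ :=
  ⟨Matrix.diagonal fun x => if x = k then Complex.I else 1, by
    rw [Matrix.mem_unitaryGroup_iff, Matrix.star_eq_conjTranspose, Matrix.diagonal_conjTranspose,
      Matrix.diagonal_mul_diagonal, ← Matrix.diagonal_one]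
    congr 1
    funext x
    by_cases hx : x = k <;> simp [hx]⟩

/-- Invariance under diagonal phases annihilates every entry whose row and column do not carry the
same unordered pair of indices. -/
theorem apply_eq_zero_of_phase_invariant {T : Matrix (n × n) (n × n) ℂ}
    (h : ∀ k, conjTensorSq T (phaseUnitary k) = T) {s s' t t' : n}
    (h₁ : (s, s') ≠ (t, t')) (h₂ : (s, s') ≠ (t', t)) : T (s, s') (t, t') = 0 := by
  by_contra hT
  have key : ∀ k, (if t = k then Complex.I else 1) * (if t' = k then Complex.I else 1) =
      (if s = k then Complex.I else 1) * (if s' = k then Complex.I else 1) := by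
    intro k
    have := congrFun (congrFun (mul_kronecker_self_comm (h k)) (s, s')) (t, t')
    simp only [phaseUnitary, Matrix.diagonal_kronecker_diagonal, Matrix.mul_diagonal,
      Matrix.diagonal_mul] at this
    rw [mul_comm] at this
    exact mul_right_cancel₀ hT this
  have hI : Complex.I ≠ 1 := fun h => by simpa using congrArg Complex.re h
  have hI' : (1 : ℂ) ≠ Complex.I := hI.symm
  have hII : Complex.I * Complex.I ≠ 1 := fun h => by norm_num [Complex.I_mul_I] at h
  have hII' : Complex.I * Complex.I ≠ Complex.I := fun h => by
    simpa using congrArg Complex.im h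
  have ks := key s
  have ks' := key s'
  simp only [ne_eq, Prod.mk.injEq, not_and] at h₁ h₂
  generalize Complex.I = z at *
  clear key hT h
  grind

theorem permMatrix_mem_unitaryGroup (σ : Equiv.Perm n) :
    σ.permMatrix ℂ ∈ Matrix.unitaryGroup n ℂ := by
  rw [Matrix.mem_unitaryGroup_iff, Matrix.star_eq_conjTranspose, Matrix.conjTranspose_permMatrix,
    ← Matrix.permMatrix_mul, inv_mul_cancel, Matrix.permMatrix_one]

theorem apply_perm_of_invariant {T : Matrix (n × n) (n × n) ℂ} {σ : Equiv.Perm n}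
    (h : conjTensorSq T ⟨σ.permMatrix ℂ, permMatrix_mem_unitaryGroup σ⟩ = T) (s s' t t' : n) :
    T (σ s, σ s') (σ t, σ t') = T (s, s') (t, t') := by
  have := congrFun (congrFun (mul_kronecker_self_comm h) (s, s')) (σ t, σ t')
  simp only [Matrix.mul_apply, Fintype.sum_prod_type, Matrix.kroneckerMap_apply,
    Equiv.Perm.permMatrix, PEquiv.toMatrix_apply, Equiv.toPEquiv_apply, Option.mem_def,
    Option.some.injEq, EmbeddingLike.apply_eq_iff_eq] at this
  simpa using this.symm

/-- A rational reflection in the plane of the coordinates `s` and `t`, namely `1 - (2 / 5) u uᵀ`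
with `u = e_s + 2 e_t`. Its column `s` has the entries `3 / 5` at `s` and `-4 / 5` at `t`,
both non-zero. -/
noncomputable def reflectionUnitary (s t : n) (hst : s ≠ t) : Matrix.unitaryGroup n ℂ :=
  ⟨1 - (2 / 5 : ℂ) • Matrix.vecMulVec (Pi.single s 1 + Pi.single t 2)
      (Pi.single s 1 + Pi.single t 2), by
    have hstar : star (Pi.single s 1 + Pi.single t 2 : n → ℂ) = Pi.single s 1 + Pi.single t 2 := by
      ext x
      by_cases hx : x = t <;> simp [Pi.single_apply, apply_ite (starRingEnd ℂ), hx]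
    have hdot : (Pi.single s 1 + Pi.single t 2 : n → ℂ) ⬝ᵥ (Pi.single s 1 + Pi.single t 2) = 5 := by
      simp [dotProduct_add, hst, hst.symm]
      norm_num
    rw [Matrix.mem_unitaryGroup_iff, Matrix.star_eq_conjTranspose, Matrix.conjTranspose_sub,
      Matrix.conjTranspose_smul, Matrix.conjTranspose_vecMulVec, hstar, Matrix.conjTranspose_one]
    have h2 : star (2 / 5 : ℂ) = 2 / 5 := by simp
    rw [h2]
    simp only [sub_mul, mul_sub, one_mul, mul_one, smul_mul_assoc, mul_smul_comm,
      Matrix.vecMulVec_mul_vecMulVec, hdot, Matrix.vecMulVec_smul]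
    module⟩

/-- The operator on `ℂⁿ ⊗ ℂⁿ` exchanging the two tensor factors. -/
abbrev swapMatrix (n : Type*) [Fintype n] [DecidableEq n] : Matrix (n × n) (n × n) ℂ :=
  Equiv.Perm.permMatrix ℂ (Equiv.prodComm n n)

theorem swapMatrix_apply (s s' t t' : n) :
    swapMatrix n (s, s') (t, t') = if s' = t ∧ s = t' then 1 else 0 := by
  simp [PEquiv.toMatrix_apply, Equiv.toPEquiv_apply]

/-- Schur-Weyl duality for two tensor factors: an operator commuting with all `V ⊗ V` is a linear
combination of the identity and the swap. Phases leave only the entries `(st, st)` and `(st, ts)`,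
permutations make these independent of `s ≠ t`, and a reflection in a coordinate plane
fixes the entries `(ss, ss)`. -/
theorem exists_eq_one_add_swap {T : Matrix (n × n) (n × n) ℂ}
    (h : ∀ V, conjTensorSq T V = T) :
    ∃ p q : ℂ, T = p • 1 + q • swapMatrix n ∧ (Subsingleton n → q = 0) := by
  rcases subsingleton_or_nontrivial n with hn | hn
  · rcases isEmpty_or_nonempty n with he | ⟨⟨x⟩⟩
    · exact ⟨0, 0, by ext ⟨i, _⟩; exact he.elim i, fun _ => rfl⟩
    · refine ⟨T (x, x) (x, x), 0, ?_, fun _ => rfl⟩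
      ext i j
      rw [Subsingleton.elim i (x, x), Subsingleton.elim j (x, x)]
      simp
  obtain ⟨a, b, hab⟩ := exists_pair_ne n
  have htrans : ∀ {s t : n}, s ≠ t → ∃ σ : Equiv.Perm n, σ a = s ∧ σ b = t := fun hst =>
    MulAction.is_two_pretransitive_iff.mp
      (Equiv.Perm.isMultiplyPretransitive n 2) hab hst
  have hp : ∀ {s t : n}, s ≠ t → T (s, t) (s, t) = T (a, b) (a, b) := by
    intro s t hst
    obtain ⟨σ, rfl, rfl⟩ := htrans hst
    exact apply_perm_of_invariant (h _) _ _ _ _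
  have hq : ∀ {s t : n}, s ≠ t → T (s, t) (t, s) = T (a, b) (b, a) := by
    intro s t hst
    obtain ⟨σ, rfl, rfl⟩ := htrans hst
    exact apply_perm_of_invariant (h _) _ _ _ _
  have hzero : ∀ {s s' t t' : n}, (s, s') ≠ (t, t') → (s, s') ≠ (t', t) →
      T (s, s') (t, t') = 0 := fun h₁ h₂ =>
    apply_eq_zero_of_phase_invariant (fun k => h _) h₁ h₂
  have hr : ∀ s : n, T (s, s) (s, s) = T (a, b) (a, b) + T (a, b) (b, a) := by
    intro s
    obtain ⟨t, hts⟩ := exists_ne s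
    -- The entry `(st, ss)` of `T (V ⊗ V) = (V ⊗ V) T` for the reflection `V`.
    have key := congrFun (congrFun (mul_kronecker_self_comm
      (h (reflectionUnitary s t hts.symm))) (s, t)) (s, s)
    set V : Matrix n n ℂ := (reflectionUnitary s t hts.symm : Matrix n n ℂ) with hV
    have hss : V s s = 3 / 5 := by
      simp [hV, reflectionUnitary, Matrix.vecMulVec_apply, hts.symm]
      norm_num
    have hVts : V t s = -(4 / 5) := by
      simp [hV, reflectionUnitary, Matrix.vecMulVec_apply, hts, hts.symm]
      norm_num
    rw [Matrix.mul_apply, Matrix.mul_apply,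
      Finset.sum_eq_add (s, t) (t, s) (by simp [hts.symm])
        (fun c _ hc => by
          obtain ⟨c, c'⟩ := c
          rw [hzero (fun h => hc.1 h.symm) (fun h => hc.2 (by simp_all)), zero_mul])
        (by simp) (by simp),
      Finset.sum_eq_single (s, s)
        (fun c _ hc => by
          obtain ⟨c, c'⟩ := c
          rw [hzero hc hc, mul_zero])
        (by simp), hp hts.symm, hq hts.symm] at key
    simp only [Matrix.kroneckerMap_apply, hss, hVts] at key
    linear_combination (25 / 12 : ℂ) * key
  refine ⟨T (a, b) (a, b), T (a, b) (b, a), ?_, fun hs => (hab (Subsingleton.elim a b)).elim⟩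
  ext ⟨s, s'⟩ ⟨t, t'⟩
  simp only [Matrix.add_apply, Matrix.smul_apply, swapMatrix_apply, Matrix.one_apply,
    Prod.mk.injEq, smul_eq_mul]
  by_cases h₁ : (s, s') = (t, t')
  · obtain ⟨rfl, rfl⟩ := Prod.mk.inj h₁
    by_cases e : s = s'
    · subst e
      simp [hr s]
    · simp [hp e, e, Ne.symm e]
  · by_cases h₂ : (s, s') = (t', t)
    · obtain ⟨rfl, rfl⟩ := Prod.mk.inj h₂
      have e : s ≠ s' := fun e => h₁ (by rw [e])
      simp [hq e, e]
    · rw [hzero h₁ h₂]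
      simp only [Prod.mk.injEq] at h₁ h₂
      rw [if_neg h₁, if_neg (fun hh => h₂ ⟨hh.2, hh.1⟩)]
      simp

end Commutant

/-! ### Partial traces and the swap trick -/

section PartialTrace

variable {c a b f : Type*}

/-- The operator on `C` obtained from an operator on `C F` by fixing the `F` indices to `i, j`. -/
def block (ρ : Matrix (c × f) (c × f) ℂ) (i j : f) : Matrix c c ℂ :=
  Matrix.of fun x y => ρ (x, i) (y, j)

/-- The partial trace over the second factor of an operator on `C`, for an identification
`e : C ≃ A B`. -/
def traceSnd [Fintype b]
    (e : c ≃ a × b) (M : Matrix c c ℂ) : Matrix a a ℂ :=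
  Matrix.of fun x x' => ∑ y, M (e.symm (x, y)) (e.symm (x', y))

/-- The partial trace over `B` of an operator on `C F`, for an identification `e : C ≃ A B`. -/
def traceB [Fintype b]
    (e : c ≃ a × b) (ρ : Matrix (c × f) (c × f) ℂ) : Matrix (a × f) (a × f) ℂ :=
  Matrix.of fun i j => traceSnd e (block ρ i.2 j.2) i.1 j.1

/-- The permutation of the basis of `C C` that exchanges the two `A` components, for an
identification `e : C ≃ A B`. -/
def swapFst (e : c ≃ a × b) : Equiv.Perm (c × c) where
  toFun r := (e.symm ((e r.2).1, (e r.1).2), e.symm ((e r.1).1, (e r.2).2))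
  invFun r := (e.symm ((e r.2).1, (e r.1).2), e.symm ((e r.1).1, (e r.2).2))
  left_inv r := by simp
  right_inv r := by simp

theorem trace_permMatrix_mul {m : Type*} [Fintype m] [DecidableEq m] (τ : Equiv.Perm m)
    (N : Matrix m m ℂ) : (τ.permMatrix ℂ * N).trace = ∑ r, N (τ r) r := by
  simp [Matrix.trace, Matrix.mul_apply, PEquiv.toMatrix_apply, Equiv.toPEquiv_apply]

/-- The swap trick: a product of partial traces is a single trace against the operator that
exchanges the two copies of `A`. -/
theorem trace_traceSnd_mul_traceSnd [Fintype c] [DecidableEq c] [Fintype a] [Fintype b]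
    (e : c ≃ a × b) (M N : Matrix c c ℂ) :
    (traceSnd e M * traceSnd e N).trace =
      ((swapFst e).permMatrix ℂ * (M ⊗ₖ N)).trace := by
  rw [trace_permMatrix_mul, ← (e.symm.prodCongr e.symm).sum_comp]
  simp only [Matrix.trace, Matrix.diag_apply, Matrix.mul_apply, traceSnd, Matrix.of_apply,
    Matrix.kroneckerMap_apply, Fintype.sum_prod_type, swapFst, Equiv.coe_fn_mk,
    Equiv.prodCongr_apply, Prod.map, Equiv.apply_symm_apply, Finset.sum_mul_sum]
  rw [Finset.sum_comm]
  refine Finset.sum_congr rfl fun x _ => ?_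
  rw [Finset.sum_comm]

theorem trace_swapFst [Fintype c] [DecidableEq c] [Fintype a] [DecidableEq a] [Fintype b] [DecidableEq b]
    (e : c ≃ a × b) : ((swapFst e).permMatrix ℂ).trace =
    Fintype.card a * (Fintype.card b : ℂ) ^ 2 := by
  have h := trace_traceSnd_mul_traceSnd e 1 1
  rw [Matrix.one_kronecker_one, Matrix.mul_one] at h
  rw [← h]
  have h1 : traceSnd e 1 = (Fintype.card b : ℂ) • (1 : Matrix a a ℂ) := by
    ext x x'
    simp [traceSnd, Matrix.one_apply]
  rw [h1]
  simp
  ring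

theorem trace_swapFst_mul_swap [Fintype c] [DecidableEq c] [Fintype a] [DecidableEq a] [Fintype b] [DecidableEq b]
    (e : c ≃ a × b) :
    ((swapFst e).permMatrix ℂ * swapMatrix c).trace =
      (Fintype.card a : ℂ) ^ 2 * Fintype.card b := by
  have h : (Equiv.prodComm c c : Equiv.Perm (c × c)) * swapFst e =
      swapFst (e.trans (Equiv.prodComm a b)) := by
    ext r <;> simp [swapFst]
  rw [swapMatrix, ← Matrix.permMatrix_mul, h, trace_swapFst, mul_comm]

/-- The operator `∑ᵢⱼ ρⁱʲ ⊗ ρʲⁱ` on `C C`: the partial trace of `ρ ⊗ ρ` against the swap of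
the two copies of `F`. -/
def swapContraction [Fintype f]
    (ρ : Matrix (c × f) (c × f) ℂ) : Matrix (c × c) (c × c) ℂ :=
  ∑ i, ∑ j, block ρ i j ⊗ₖ block ρ j i

theorem trace_traceB_mul_self [Fintype c] [DecidableEq c] [Fintype a] [Fintype b] [Fintype f]
    (e : c ≃ a × b) (ρ : Matrix (c × f) (c × f) ℂ) :
    (traceB e ρ * traceB e ρ).trace =
      ((swapFst e).permMatrix ℂ * swapContraction ρ).trace := by
  simp only [swapContraction, Matrix.mul_sum, Matrix.trace_sum, ← trace_traceSnd_mul_traceSnd]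
  simp only [Matrix.trace, Matrix.diag_apply, Matrix.mul_apply, Fintype.sum_prod_type, traceB,
    Matrix.of_apply]
  rw [Finset.sum_comm]
  refine Finset.sum_congr rfl fun i _ => ?_
  rw [Finset.sum_congr rfl fun x _ => Finset.sum_comm, Finset.sum_comm]

theorem trace_swapContraction [Fintype c] [Fintype f]
    (ρ : Matrix (c × f) (c × f) ℂ) :
    (swapContraction ρ).trace = (traceC ρ * traceC ρ).trace := by
  simp only [swapContraction, Matrix.trace_sum, Matrix.trace_kronecker]
  simp [Matrix.trace, Matrix.mul_apply, traceC, block]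

theorem trace_swap_mul_swapContraction [Fintype c] [DecidableEq c] [Fintype f]
    (ρ : Matrix (c × f) (c × f) ℂ) :
    (swapMatrix c * swapContraction ρ).trace = (ρ * ρ).trace := by
  simp only [swapContraction, Matrix.mul_sum, Matrix.trace_sum, trace_permMatrix_mul]
  simp only [Matrix.trace, Matrix.diag_apply, Matrix.mul_apply, Fintype.sum_prod_type_right, block,
    Matrix.of_apply, Matrix.kroneckerMap_apply, Equiv.prodComm_apply, Prod.swap_prod_mk]
  refine Finset.sum_congr rfl fun i _ => ?_
  rw [Finset.sum_comm]

theorem block_adjointAction [Fintype c] [DecidableEq c] [Fintype f] [DecidableEq f]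
    (U : Matrix.unitaryGroup c ℂ) (ρ : Matrix (c × f) (c × f) ℂ)
    (i j : f) : block (adjointAction U ρ) i j =
      (U : Matrix c c ℂ) * block ρ i j * (U : Matrix c c ℂ)ᴴ := by
  ext x y
  simp [block, adjointAction, Matrix.mul_apply, Fintype.sum_prod_type, Matrix.one_apply,
    Matrix.star_eq_conjTranspose]

theorem swapContraction_adjointAction [Fintype c] [DecidableEq c] [Fintype f] [DecidableEq f]
    (U : Matrix.unitaryGroup c ℂ)
    (ρ : Matrix (c × f) (c × f) ℂ) : swapContraction (adjointAction U ρ) =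
      ((U : Matrix c c ℂ) ⊗ₖ (U : Matrix c c ℂ)) * swapContraction ρ *
        ((U : Matrix c c ℂ) ⊗ₖ (U : Matrix c c ℂ))ᴴ := by
  simp only [swapContraction, block_adjointAction, Matrix.mul_sum, Matrix.sum_mul,
    Matrix.conjTranspose_kronecker, Matrix.mul_kronecker_mul]

theorem trace_traceB_adjointAction_mul_self [Fintype c] [DecidableEq c] [Fintype a] [Fintype b] [Fintype f] [DecidableEq f]
    (e : c ≃ a × b) (U : Matrix.unitaryGroup c ℂ)
    (ρ : Matrix (c × f) (c × f) ℂ) :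
    (traceB e (adjointAction U ρ) * traceB e (adjointAction U ρ)).trace =
      (conjTensorSq ((swapFst e).permMatrix ℂ) U * swapContraction ρ).trace := by
  rw [trace_traceB_mul_self, swapContraction_adjointAction, conjTensorSq, ← Matrix.mul_assoc,
    Matrix.trace_mul_comm]
  simp only [Matrix.mul_assoc]

theorem traceC_adjointAction [Fintype c] [DecidableEq c] [Fintype f] [DecidableEq f]
    (U : Matrix.unitaryGroup c ℂ) (ρ : Matrix (c × f) (c × f) ℂ) :
    traceC (adjointAction U ρ) = traceC ρ := by
  ext i j
  have hU := Matrix.mem_unitaryGroup_iff'.mp U.2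
  rw [Matrix.star_eq_conjTranspose] at hU
  change (block (adjointAction U ρ) i j).trace = (block ρ i j).trace
  rw [block_adjointAction, Matrix.trace_mul_comm, ← Matrix.mul_assoc, hU, Matrix.one_mul]

theorem traceC_traceB [Fintype c] [Fintype a] [Fintype b]
    (e : c ≃ a × b) (ρ : Matrix (c × f) (c × f) ℂ) :
    traceC (traceB e ρ) = traceC ρ := by
  ext i j
  simp only [traceC, traceB, traceSnd, block, Matrix.of_apply]
  rw [← e.symm.sum_comp, Fintype.sum_prod_type]

theorem isHermitian_traceB [Fintype b]
    (e : c ≃ a × b) {ρ : Matrix (c × f) (c × f) ℂ} (hρ : ρ.IsHermitian) :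
    (traceB e ρ).IsHermitian := by
  ext i j
  simp [traceB, traceSnd, block, hρ.apply]

theorem isHermitian_traceC [Fintype c] {ρ : Matrix (c × f) (c × f) ℂ} (hρ : ρ.IsHermitian) :
    (traceC ρ).IsHermitian := by
  ext i j
  simp [traceC, hρ.apply]

theorem isHermitian_adjointAction [Fintype c] [DecidableEq c] [Fintype f] [DecidableEq f]
    (U : Matrix.unitaryGroup c ℂ) {ρ : Matrix (c × f) (c × f) ℂ}
    (hρ : ρ.IsHermitian) : (adjointAction U ρ).IsHermitian := by
  have := Matrix.isHermitian_mul_mul_conjTranspose ((U : Matrix c c ℂ) ⊗ₖ (1 : Matrix f f ℂ)) hρ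
  rwa [Matrix.conjTranspose_kronecker, Matrix.conjTranspose_one] at this

theorem isHermitian_maxMixed_kronecker [Fintype a] [DecidableEq a] {σ : Matrix f f ℂ} (hσ : σ.IsHermitian) :
    (maxMixed a ⊗ₖ σ).IsHermitian := by
  ext i j
  by_cases h : i.1 = j.1
  · simp [maxMixed, hσ.apply, h]
  · simp [maxMixed, h, Ne.symm h]

theorem trace_mul_maxMixed_kronecker [Fintype a] [DecidableEq a] [Fintype f]
    (σ : Matrix (a × f) (a × f) ℂ) (τ : Matrix f f ℂ) :
    (σ * (maxMixed a ⊗ₖ τ)).trace = (Fintype.card a : ℂ)⁻¹ * (traceC σ * τ).trace := by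
  simp [maxMixed, Matrix.trace, Matrix.mul_apply, Fintype.sum_prod_type, Matrix.one_apply, traceC,
    Finset.mul_sum, Finset.sum_mul]
  rw [Finset.sum_comm]
  refine Finset.sum_congr rfl fun i _ => ?_
  rw [Finset.sum_comm]
  refine Finset.sum_congr rfl fun j _ => Finset.sum_congr rfl fun x _ => ?_
  ring

theorem traceC_maxMixed_kronecker [Fintype a] [DecidableEq a] [Nonempty a] (τ : Matrix f f ℂ) :
    traceC (maxMixed a ⊗ₖ τ) = τ := by
  ext i j
  simp [traceC, maxMixed]

end PartialTrace

/-! ### Trace norm and purity -/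

section TraceNorm

variable {m : Type*} [Fintype m]

theorem trace_conjTranspose_mul_self_re (M : Matrix m m ℂ) :
    (Mᴴ * M).trace.re = ∑ i, ∑ j, ‖M j i‖ ^ 2 := by
  simp only [Matrix.trace, Matrix.diag_apply, Matrix.mul_apply, Matrix.conjTranspose_apply,
    Complex.re_sum, Complex.star_def]
  refine Finset.sum_congr rfl fun i _ => Finset.sum_congr rfl fun j _ => ?_
  rw [← Complex.normSq_eq_conj_mul_self, Complex.ofReal_re, Complex.normSq_eq_norm_sq]

theorem purity_eq_sum {M : Matrix m m ℂ} (hM : M.IsHermitian) :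
    purity M = ∑ i, ∑ j, ‖M j i‖ ^ 2 := by
  rw [← trace_conjTranspose_mul_self_re, hM.eq, purity]

theorem trace_mul_self_eq_purity {M : Matrix m m ℂ} (hM : M.IsHermitian) :
    (M * M).trace = purity M := by
  refine (Complex.conj_eq_iff_re.mp ?_).symm
  rw [← Complex.star_def, ← Matrix.trace_conjTranspose, Matrix.conjTranspose_mul, hM.eq]

theorem purity_nonneg {M : Matrix m m ℂ} (hM : M.IsHermitian) : 0 ≤ purity M := by
  rw [purity_eq_sum hM]
  positivity

theorem purity_pos {M : Matrix m m ℂ} (hM : M.IsHermitian) (h0 : M ≠ 0) : 0 < purity M := by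
  refine (purity_nonneg hM).lt_of_ne' fun h => h0 ?_
  rw [purity_eq_sum hM, Finset.sum_eq_zero_iff_of_nonneg (fun _ _ => by positivity)] at h
  ext j i
  have := h i (Finset.mem_univ i)
  rw [Finset.sum_eq_zero_iff_of_nonneg (fun _ _ => by positivity)] at this
  simpa using this j (Finset.mem_univ j)

/-- The Cauchy-Schwarz inequality between the trace norm and the Hilbert-Schmidt norm. -/
theorem traceNorm_sq_le [DecidableEq m] {M : Matrix m m ℂ} (hM : M.IsHermitian) :
    traceNorm M ^ 2 ≤ Fintype.card m * purity M := by
  set S := CFC.sqrt (Mᴴ * M) with hS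
  have hS0 : S.PosSemidef := Matrix.nonneg_iff_posSemidef.mp (CFC.sqrt_nonneg _)
  have hSS : S * S = Mᴴ * M := CFC.sqrt_mul_sqrt_self _
    (Matrix.nonneg_iff_posSemidef.mpr (Matrix.posSemidef_conjTranspose_mul_self M))
  have h1 : purity M = purity S := by
    rw [purity, purity, hSS, hM.eq]
  rw [h1, purity_eq_sum hS0.isHermitian]
  calc traceNorm M ^ 2 = (∑ i, (S i i).re) ^ 2 := by
        simp [traceNorm, ← hS, Matrix.trace]
    _ ≤ Fintype.card m * ∑ i, (S i i).re ^ 2 := by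
        simpa using sq_sum_le_card_mul_sum_sq (s := Finset.univ) (f := fun i => (S i i).re)
    _ ≤ Fintype.card m * ∑ i, ∑ j, ‖S j i‖ ^ 2 := by
        gcongr with i
        calc (S i i).re ^ 2 ≤ ‖S i i‖ ^ 2 := by
              rw [← sq_abs]
              gcongr
              exact Complex.abs_re_le_norm _
          _ ≤ ∑ j, ‖S j i‖ ^ 2 :=
              Finset.single_le_sum (f := fun j => ‖S j i‖ ^ 2) (fun _ _ => by positivity)
                (Finset.mem_univ i)

end TraceNorm

/-! ### The average decoupling error -/

section Average

variable {c a b f : Type*} [Fintype c] [DecidableEq c] [Fintype a] [DecidableEq a]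
  [Fintype b] [DecidableEq b] [Fintype f] [DecidableEq f]

/-- The deviation `Tr_B (U · ρ) - π_A ⊗ ρ_F` of the reduced state from the decoupled one. -/
noncomputable def decouplingError (e : c ≃ a × b) (ρ : Matrix (c × f) (c × f) ℂ)
    (U : Matrix.unitaryGroup c ℂ) : Matrix (a × f) (a × f) ℂ :=
  traceB e (adjointAction U ρ) - maxMixed a ⊗ₖ traceC ρ

omit [DecidableEq b] in
theorem isHermitian_decouplingError (e : c ≃ a × b) {ρ : Matrix (c × f) (c × f) ℂ}
    (hρ : ρ.IsHermitian) (U : Matrix.unitaryGroup c ℂ) :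
    (decouplingError e ρ U).IsHermitian :=
  (isHermitian_traceB e (isHermitian_adjointAction U hρ)).sub
    (isHermitian_maxMixed_kronecker (isHermitian_traceC hρ))

omit [DecidableEq b] in
theorem purity_decouplingError [Nonempty a] (e : c ≃ a × b) (ρ : Matrix (c × f) (c × f) ℂ)
    (U : Matrix.unitaryGroup c ℂ) :
    purity (decouplingError e ρ U) =
      (conjTensorSq ((swapFst e).permMatrix ℂ) U * swapContraction ρ).trace.re -
        (Fintype.card a : ℝ)⁻¹ * purity (traceC ρ) := by
  have h : (decouplingError e ρ U * decouplingError e ρ U).trace =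
      (conjTensorSq ((swapFst e).permMatrix ℂ) U * swapContraction ρ).trace -
        ((Fintype.card a : ℝ)⁻¹ : ℝ) * (traceC ρ * traceC ρ).trace := by
    rw [← trace_traceB_adjointAction_mul_self, decouplingError, sub_mul, mul_sub, mul_sub,
      Matrix.trace_sub, Matrix.trace_sub, Matrix.trace_sub,
      Matrix.trace_mul_comm (maxMixed a ⊗ₖ traceC ρ) (traceB _ _), trace_mul_maxMixed_kronecker,
      trace_mul_maxMixed_kronecker, traceC_traceB, traceC_adjointAction, traceC_maxMixed_kronecker]
    push_cast
    ring
  rw [purity, h, Complex.sub_re, Complex.re_ofReal_mul, purity]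

omit [DecidableEq b] in
theorem continuous_purity_decouplingError [Nonempty a] (e : c ≃ a × b)
    (ρ : Matrix (c × f) (c × f) ℂ) :
    Continuous fun U => purity (decouplingError e ρ U) := by
  simp_rw [purity_decouplingError]
  exact (Complex.continuous_re.comp (((continuous_conjTensorSq _).matrix_mul
    continuous_const).matrix_trace)).sub continuous_const

/-- The two coefficients of the twirled partial swap. In dimension one the identity and the swap
coincide, so `q = 0` has to be assumed there. -/
theorem twirl_coefficients_le {a b : ℕ} (ha : 0 < a) (hb : 0 < b) {p q : ℝ}
    (h1 : p * (a * b) ^ 2 + q * (a * b) = a * b ^ 2)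
    (h2 : p * (a * b) + q * (a * b) ^ 2 = a ^ 2 * b) (h3 : a * b = 1 → q = 0) :
    p ≤ (a : ℝ)⁻¹ ∧ q ≤ (b : ℝ)⁻¹ := by
  have ha' : (1 : ℝ) ≤ a := by exact_mod_cast ha
  have hb' : (1 : ℝ) ≤ b := by exact_mod_cast hb
  have ha0 : (0 : ℝ) < a := by linarith
  have hb0 : (0 : ℝ) < b := by linarith
  have e1 : p * (a * b) + q = b := by
    have : (a * b : ℝ) * (p * (a * b) + q) = (a * b) * b := by linear_combination h1
    exact mul_left_cancel₀ (by positivity) this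
  have e2 : p + q * (a * b) = a := by
    have : (a * b : ℝ) * (p + q * (a * b)) = (a * b) * a := by linear_combination h2
    exact mul_left_cancel₀ (by positivity) this
  rw [← one_div, ← one_div, le_div_iff₀ ha0, le_div_iff₀ hb0]
  by_cases hab : a * b = 1
  · have hq := h3 hab
    have hb1 : b = 1 := Nat.eq_one_of_mul_eq_one_left hab
    have ha1 : a = 1 := Nat.eq_one_of_mul_eq_one_right hab
    subst hq ha1 hb1
    norm_num at e1 ⊢
    exact e1.le
  · have hd : (1 : ℝ) < a * b := by
      have : 1 < a * b := lt_of_le_of_ne (Nat.mul_pos ha hb) (Ne.symm hab)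
      exact_mod_cast this
    have hd2 : (0 : ℝ) < (a * b) ^ 2 - 1 := by nlinarith
    have f1 : p * a * ((a * b) ^ 2 - 1) = (a * b) ^ 2 - a ^ 2 := by
      linear_combination (a * (a * b) : ℝ) * e1 - (a : ℝ) * e2
    have f2 : q * b * ((a * b) ^ 2 - 1) = (a * b) ^ 2 - b ^ 2 := by
      linear_combination (b * (a * b) : ℝ) * e2 - (b : ℝ) * e1
    constructor
    · refine le_of_mul_le_mul_right ?_ hd2
      rw [f1]
      nlinarith
    · refine le_of_mul_le_mul_right ?_ hd2
      rw [f2]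
      nlinarith

theorem commute_kronecker_self_swapMatrix (U : Matrix c c ℂ) :
    Commute (U ⊗ₖ U) (swapMatrix c) := by
  rw [commute_iff_eq, swapMatrix, PEquiv.mul_toMatrix_toPEquiv, PEquiv.toMatrix_toPEquiv_mul]
  ext i j
  simp [mul_comm]

theorem trace_swapMatrix : (swapMatrix c).trace = Fintype.card c := by
  have h (x y : c) : (y = x ∧ x = y) ↔ y = x := ⟨And.left, fun h => ⟨h, h.symm⟩⟩
  simp only [Matrix.trace, Matrix.diag_apply, Fintype.sum_prod_type, swapMatrix_apply, h]
  simp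

theorem trace_conjTensorSq_mul_of_commute (X : Matrix (c × c) (c × c) ℂ)
    (U : Matrix.unitaryGroup c ℂ) {B : Matrix (c × c) (c × c) ℂ}
    (hB : Commute ((U : Matrix c c ℂ) ⊗ₖ (U : Matrix c c ℂ)) B) :
    (conjTensorSq X U * B).trace = (X * B).trace := by
  have hU := (Matrix.mem_unitaryGroup_iff).mp (kronecker_self_mem_unitaryGroup U)
  rw [Matrix.star_eq_conjTranspose] at hU
  rw [conjTensorSq, mul_assoc, hB.eq, mul_assoc, Matrix.trace_mul_comm]
  simp only [mul_assoc]
  rw [hU, mul_one]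

/-- Averaging over the unitary group gives `p Tr ρ_F² + q Tr ρ² - Tr ρ_F² / d_A` with `p ≤ 1 / d_A`
and `q ≤ 1 / d_B`. -/
theorem integral_purity_decouplingError_le [Nonempty a] [Nonempty b]
    [MeasurableSpace (Matrix.unitaryGroup c ℂ)] [BorelSpace (Matrix.unitaryGroup c ℂ)]
    (μ : Measure (Matrix.unitaryGroup c ℂ)) [IsProbabilityMeasure μ] [μ.IsMulRightInvariant]
    (e : c ≃ a × b) {ρ : Matrix (c × f) (c × f) ℂ} (hρ : ρ.IsHermitian) :
    ∫ U, purity (decouplingError e ρ U) ∂μ ≤ purity ρ / Fintype.card b := by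
  set X := (swapFst e).permMatrix ℂ with hX
  have hcard : Fintype.card c = Fintype.card a * Fintype.card b := by
    rw [Fintype.card_congr e, Fintype.card_prod]
  obtain ⟨p, q, hT, hq⟩ := exists_eq_one_add_swap (conjTensorSq_twirl μ X)
  have hswap : ∀ U : Matrix.unitaryGroup c ℂ,
      (conjTensorSq X U * swapMatrix c).trace = (X * swapMatrix c).trace := fun U =>
    trace_conjTensorSq_mul_of_commute X U (commute_kronecker_self_swapMatrix _)
  have hone : ∀ U : Matrix.unitaryGroup c ℂ, (conjTensorSq X U * 1).trace = X.trace := fun U => by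
    rw [trace_conjTensorSq_mul_of_commute X U (Commute.one_right _), mul_one]
  have htr : ∀ B, (twirl μ X * B).trace = p * B.trace + q * (swapMatrix c * B).trace := by
    intro B
    rw [hT, add_mul, Matrix.trace_add, Matrix.smul_mul, Matrix.smul_mul, Matrix.trace_smul,
      Matrix.trace_smul, Matrix.one_mul, smul_eq_mul, smul_eq_mul]
  have hss : swapMatrix c * swapMatrix c = 1 := by
    rw [swapMatrix, ← Matrix.permMatrix_mul, ← Matrix.permMatrix_one]
    congr 1
  have h1 := htr 1
  have h2 := htr (swapMatrix c)
  rw [trace_twirl_mul] at h1 h2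
  simp_rw [hone] at h1
  simp_rw [hswap] at h2
  rw [integral_const, probReal_univ, one_smul, hX, trace_swapFst, mul_one, Matrix.trace_one, trace_swapMatrix,
    Fintype.card_prod, hcard] at h1
  rw [integral_const, probReal_univ, one_smul, hX, trace_swapFst_mul_swap, hss, Matrix.trace_one,
    trace_swapMatrix, Fintype.card_prod, hcard] at h2
  have g1 := congrArg Complex.re h1
  have g2 := congrArg Complex.re h2
  push_cast at g1 g2
  have hpq := twirl_coefficients_le (a := Fintype.card a) (b := Fintype.card b) (p := p.re)
    (q := q.re) Fintype.card_pos Fintype.card_pos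
    (by
      norm_cast at g1
      simp only [Complex.add_re, Complex.mul_re, Complex.natCast_re,
        Complex.natCast_im] at g1
      push_cast at g1
      linarith)
    (by
      norm_cast at g2
      simp only [Complex.add_re, Complex.mul_re, Complex.natCast_re,
        Complex.natCast_im] at g2
      push_cast at g2
      linarith)
    (fun h => by
      have := hq (Fintype.card_le_one_iff_subsingleton.mp (by rw [hcard, h]))
      rw [this, Complex.zero_re])
  have hint : ∫ U, (conjTensorSq X U * swapContraction ρ).trace.re ∂μ =
      p.re * purity (traceC ρ) + q.re * purity ρ := by
    have hre := integral_re (𝕜 := ℂ) (integrable_of_continuous_unitaryGroup μ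
      (((continuous_conjTensorSq X).matrix_mul
        (continuous_const (y := swapContraction ρ))).matrix_trace))
    refine hre.trans ?_
    rw [← trace_twirl_mul, htr, trace_swapContraction, trace_swap_mul_swapContraction,
      trace_mul_self_eq_purity hρ, trace_mul_self_eq_purity (isHermitian_traceC hρ)]
    simp
  simp_rw [purity_decouplingError]
  have hintegrable : Integrable
      (fun U => (conjTensorSq X U * swapContraction ρ).trace.re) μ :=
    integrable_of_continuous_unitaryGroup μ (Complex.continuous_re.comp
      (((continuous_conjTensorSq X).matrix_mul continuous_const).matrix_trace))
  rw [integral_sub hintegrable (integrable_const _), hint, integral_const, probReal_univ, one_smul]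
  have w1 := mul_le_mul_of_nonneg_right hpq.1 (purity_nonneg (isHermitian_traceC hρ))
  have w2 := mul_le_mul_of_nonneg_right hpq.2 (purity_nonneg hρ)
  rw [div_eq_inv_mul]
  linarith

/-- Markov's inequality for two quantities at once: some point does not exceed twice the average
of either. -/
theorem exists_le_two_mul_and_le_two_mul {Ω : Type*} [MeasurableSpace Ω] {μ : Measure Ω}
    [IsProbabilityMeasure μ] {g h : Ω → ℝ} (hg : Integrable g μ) (hh : Integrable h μ)
    (hg0 : ∀ x, 0 ≤ g x) (hh0 : ∀ x, 0 ≤ h x) {A B : ℝ} (hA : 0 < A) (hB : 0 < B)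
    (hgA : ∫ x, g x ∂μ ≤ A) (hhB : ∫ x, h x ∂μ ≤ B) :
    ∃ x, g x ≤ 2 * A ∧ h x ≤ 2 * B := by
  obtain ⟨x, hx⟩ := exists_le_integral ((hg.div_const A).add (hh.div_const B))
  have hx' : g x / A + h x / B ≤ 2 := by
    refine hx.trans ?_
    simp only [Pi.add_apply]
    rw [integral_add (hg.div_const A) (hh.div_const B), integral_div, integral_div]
    have := (div_le_one hA).mpr hgA
    have := (div_le_one hB).mpr hhB
    linarith
  have h1 : 0 ≤ g x / A := div_nonneg (hg0 x) hA.le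
  have h2 : 0 ≤ h x / B := div_nonneg (hh0 x) hB.le
  exact ⟨x, (div_le_iff₀ hA).mp (by linarith), (div_le_iff₀ hB).mp (by linarith)⟩

end Average

/-! ### The decoupling theorem -/

theorem purity_pos_of_isDensityOperator {m : Type*} [Fintype m] {ρ : Matrix m m ℂ}
    (hρ : IsDensityOperator ρ) : 0 < purity ρ :=
  purity_pos hρ.1.isHermitian fun h => by simpa [h] using hρ.2

theorem traceNorm_decouplingError_sq_le {c a b f : Type*} [Fintype c] [DecidableEq c]
    [Fintype a] [DecidableEq a] [Fintype b] [Nonempty b] [Fintype f] [DecidableEq f]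
    (e : c ≃ a × b) {ρ : Matrix (c × f) (c × f) ℂ} (hρ : ρ.IsHermitian)
    {U : Matrix.unitaryGroup c ℂ}
    (hU : purity (decouplingError e ρ U) ≤ 2 * (purity ρ / Fintype.card b)) :
    traceNorm (decouplingError e ρ U) ^ 2 ≤
      2 * ((Fintype.card c : ℝ) * (Fintype.card f : ℝ) * purity ρ / (Fintype.card b : ℝ) ^ 2) := by
  have hb : (Fintype.card b : ℝ) ≠ 0 := by exact_mod_cast Fintype.card_ne_zero
  refine (traceNorm_sq_le (isHermitian_decouplingError e hρ U)).trans
    ((mul_le_mul_of_nonneg_left hU (Nat.cast_nonneg _)).trans_eq ?_)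
  rw [Fintype.card_congr e, Fintype.card_prod, Fintype.card_prod]
  push_cast
  field_simp

theorem traceB_refl {c₁ c₂ c₃ f : Type*} [Fintype c₂] [Fintype c₃]
    (ρ : Matrix ((c₁ × c₂ × c₃) × f) ((c₁ × c₂ × c₃) × f) ℂ) :
    traceB (Equiv.refl (c₁ × c₂ × c₃)) ρ = traceC2C3 ρ := by
  ext i j
  simp [traceB, traceSnd, block, traceC2C3, Fintype.sum_prod_type]

/-- The reordering `C₁ C₂ C₃ ≃ C₂ (C₁ C₃)`. -/
def middleEquiv (c₁ c₂ c₃ : Type*) : c₁ × c₂ × c₃ ≃ c₂ × c₁ × c₃ where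
  toFun x := (x.2.1, x.1, x.2.2)
  invFun x := (x.2.1, x.1, x.2.2)
  left_inv _ := rfl
  right_inv _ := rfl

theorem traceB_middleEquiv {c₁ c₂ c₃ f : Type*} [Fintype c₁] [Fintype c₃]
    (ρ : Matrix ((c₁ × c₂ × c₃) × f) ((c₁ × c₂ × c₃) × f) ℂ) :
    traceB (middleEquiv c₁ c₂ c₃) ρ = traceC1C3 ρ := by
  ext i j
  simp [traceB, traceSnd, block, traceC1C3, middleEquiv, Fintype.sum_prod_type]

theorem theorem1 {c₁ c₂ c₃ f e : Type*}
    [Fintype c₁] [DecidableEq c₁] [Fintype c₂] [DecidableEq c₂] [Fintype c₃] [DecidableEq c₃]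
    [Fintype f] [DecidableEq f] [Fintype e] [DecidableEq e]
    (ω : Matrix ((c₁ × c₂ × c₃) × f) ((c₁ × c₂ × c₃) × f) ℂ) (hω : IsDensityOperator ω)
    (ψ : Matrix ((c₁ × c₂ × c₃) × e) ((c₁ × c₂ × c₃) × e) ℂ) (hψ : IsDensityOperator ψ) :
    ∃ U : Matrix.unitaryGroup (c₁ × c₂ × c₃) ℂ,
      traceNorm (traceC2C3 (adjointAction U ω) - maxMixed c₁ ⊗ₖ traceC ω) ^ 2 ≤
        2 * ((Fintype.card (c₁ × c₂ × c₃) : ℝ) * (Fintype.card f : ℝ) * purity ω /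
          (Fintype.card (c₂ × c₃) : ℝ) ^ 2) ∧
      traceNorm (traceC1C3 (adjointAction U ψ) - maxMixed c₂ ⊗ₖ traceC ψ) ^ 2 ≤
        2 * ((Fintype.card (c₁ × c₂ × c₃) : ℝ) * (Fintype.card e : ℝ) * purity ψ /
          (Fintype.card (c₁ × c₃) : ℝ) ^ 2) := by
  have hne : Nonempty (c₁ × c₂ × c₃) := by
    -- A trace over an empty index type is zero, not one.
    by_contra h
    rw [not_nonempty_iff] at h
    simpa [Matrix.trace] using hω.2
  obtain ⟨⟨x₁, x₂, x₃⟩⟩ := hne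
  have : Nonempty c₁ := ⟨x₁⟩
  have : Nonempty c₂ := ⟨x₂⟩
  have : Nonempty c₃ := ⟨x₃⟩
  obtain ⟨_, _, μ, _, _⟩ := exists_rightInvariant_probability (n := c₁ × c₂ × c₃)
  have hω' := hω.1.isHermitian
  have hψ' := hψ.1.isHermitian
  let e₁ := Equiv.refl (c₁ × c₂ × c₃)
  let e₂ := middleEquiv c₁ c₂ c₃
  obtain ⟨U, hU₁, hU₂⟩ := exists_le_two_mul_and_le_two_mul
    (integrable_of_continuous_unitaryGroup μ (continuous_purity_decouplingError e₁ ω))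
    (integrable_of_continuous_unitaryGroup μ (continuous_purity_decouplingError e₂ ψ))
    (fun U => purity_nonneg (isHermitian_decouplingError e₁ hω' U))
    (fun U => purity_nonneg (isHermitian_decouplingError e₂ hψ' U))
    (div_pos (purity_pos_of_isDensityOperator hω) (Nat.cast_pos.mpr Fintype.card_pos))
    (div_pos (purity_pos_of_isDensityOperator hψ) (Nat.cast_pos.mpr Fintype.card_pos))
    (integral_purity_decouplingError_le μ e₁ hω') (integral_purity_decouplingError_le μ e₂ hψ')
  refine ⟨U, ?_, ?_⟩
  · simpa only [decouplingError, e₁, traceB_refl] using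
      traceNorm_decouplingError_sq_le e₁ hω' hU₁
  · simpa only [decouplingError, e₂, traceB_middleEquiv] using
      traceNorm_decouplingError_sq_le e₂ hψ' hU₂
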